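/- A Pisot number is a real algebraic integer $\theta>1$ all of whose other conjugates over $\mathbb{Q}$ have modulus strictly less than $1$. For a real number $q>1$ and a positive integer $m$, let $$X^m(q)=\Bigl\{\sum_{i=0}^n s_iq^i : n\ge 0,\ s_0,\dots,s_n\in\{0,1,\dots,m\}\Bigr\},$$ let $0=x_0^m(q)<x_1^m(q)<x_2^m(q)<\cdots$ be the enumeration of $X^m(q)$ in increasing order, and set $$L^m(q)=\limsup_{k\to\infty}\bigl(x_{k+1}^m(q)-x_k^m(q)\bigr).$$ **Proposition 1.6.** Let $P_2\approx 1.38$ be the second Pisot number, that is, the Pisot number for which exactly one Pisot number is smaller than it. Then $L^1(\sqrt{P_2})=0$. -/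

import Mathlib

/-- A Pisot number: a real algebraic integer `θ > 1` all of whose other conjugates (the other
complex roots of its minimal polynomial) have modulus strictly less than one. -/
def IsPisot (θ : ℝ) : Prop :=
  1 < θ ∧ IsIntegral ℤ θ ∧
    ∀ z : ℂ, Polynomial.aeval z (minpoly ℚ θ) = 0 → z ≠ (θ : ℂ) → ‖z‖ < 1

/-- `P` is the second Pisot number, in increasing order: it is a Pisot number, and exactly one
Pisot number is smaller than it. -/
def IsSecondPisot (P : ℝ) : Prop :=
  IsPisot P ∧ ∃! θ : ℝ, IsPisot θ ∧ θ < P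

/-- The set `X^m(q)` of all sums `s₀ + s₁ q + ⋯ + sₙ qⁿ` with `n ≥ 0` and digits
`sᵢ ∈ {0, 1, …, m}`. -/
def spectrumSet (m : ℕ) (q : ℝ) : Set ℝ :=
  {x | ∃ (n : ℕ) (s : ℕ → ℕ), (∀ i, s i ≤ m) ∧ x = ∑ i ∈ Finset.range (n + 1), (s i : ℝ) * q ^ i}

/-- The increasing enumeration `0 = x₀ < x₁ < x₂ < ⋯` of `X^m(q)`: each term is followed by the
least element of `X^m(q)` that exceeds it. For `q > 1` and `m ≥ 1` this is the strictly increasing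
sequence with range `X^m(q)`, see `spectrumSeq_strictMono` and `range_spectrumSeq`. -/
noncomputable def spectrumSeq (m : ℕ) (q : ℝ) : ℕ → ℝ
  | 0 => 0
  | k + 1 => sInf {y | y ∈ spectrumSet m q ∧ spectrumSeq m q k < y}

/-- `L^m(q) = limsup (x_{k+1} - x_k)`, as an extended real number. -/
noncomputable def bigL (m : ℕ) (q : ℝ) : EReal :=
  Filter.limsup (fun k : ℕ => ((spectrumSeq m q (k + 1) - spectrumSeq m q k : ℝ) : EReal))
    Filter.atTop

theorem zero_mem_spectrumSet (m : ℕ) (q : ℝ) : (0 : ℝ) ∈ spectrumSet m q :=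
  ⟨0, fun _ => 0, fun _ => Nat.zero_le _, by simp⟩

theorem nonneg_of_mem_spectrumSet {m : ℕ} {q : ℝ} (hq : 1 < q) {x : ℝ}
    (hx : x ∈ spectrumSet m q) : 0 ≤ x := by
  obtain ⟨n, s, -, rfl⟩ := hx
  exact Finset.sum_nonneg fun i _ => by positivity

theorem exists_gt_mem_spectrumSet {m : ℕ} {q : ℝ} (hm : 1 ≤ m) (hq : 1 < q) (B : ℝ) :
    ∃ y ∈ spectrumSet m q, B < y := by
  obtain ⟨n, hn⟩ := pow_unbounded_of_one_lt B hq
  refine ⟨q ^ n, ⟨n, fun i => if i = n then 1 else 0, fun i => ?_, ?_⟩, hn⟩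
  · dsimp only
    split_ifs <;> omega
  · simp

theorem finite_spectrumSet_le {m : ℕ} {q : ℝ} (hq : 1 < q) (B : ℝ) :
    {y | y ∈ spectrumSet m q ∧ y ≤ B}.Finite := by
  obtain ⟨N, hN⟩ := pow_unbounded_of_one_lt B hq
  refine (Set.finite_range
    (fun t : Fin N → Fin (m + 1) => ∑ i : Fin N, ((t i : ℕ) : ℝ) * q ^ (i : ℕ))).subset ?_
  rintro y ⟨⟨n, s, hs, rfl⟩, hB⟩
  have hz : ∀ i ∈ Finset.range (n + 1), N ≤ i → s i = 0 := by
    intro i hi hNi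
    by_contra h0
    have h1 : (1 : ℝ) ≤ s i := by exact_mod_cast Nat.one_le_iff_ne_zero.mpr h0
    have h2 : (s i : ℝ) * q ^ i ≤ ∑ j ∈ Finset.range (n + 1), (s j : ℝ) * q ^ j :=
      Finset.single_le_sum (f := fun j => (s j : ℝ) * q ^ j)
        (fun j _ => by positivity) hi
    have h3 : q ^ N ≤ q ^ i := pow_le_pow_right₀ hq.le hNi
    have h4 : (0 : ℝ) < q ^ i := by positivity
    nlinarith
  refine ⟨fun i => ⟨if (i : ℕ) < n + 1 then s i else 0, ?_⟩, ?_⟩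
  · have := hs i
    split_ifs <;> omega
  · dsimp only
    rw [Fin.sum_univ_eq_sum_range
      (fun i => ((if i < n + 1 then s i else 0 : ℕ) : ℝ) * q ^ i) N]
    have e1 : ∑ i ∈ Finset.range N, ((if i < n + 1 then s i else 0 : ℕ) : ℝ) * q ^ i
        = ∑ i ∈ Finset.range (max N (n + 1)),
          ((if i < n + 1 then s i else 0 : ℕ) : ℝ) * q ^ i := by
      refine Finset.sum_subset (by intro i; simp; omega) ?_
      intro i _ hi
      by_cases h : i < n + 1
      · simp [hz i (by simpa using h) (by simpa using hi)]
      · simp [h]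
    have e2 : ∑ i ∈ Finset.range (n + 1), (s i : ℝ) * q ^ i
        = ∑ i ∈ Finset.range (max N (n + 1)),
          ((if i < n + 1 then s i else 0 : ℕ) : ℝ) * q ^ i := by
      have hsub : Finset.range (n + 1) ⊆ Finset.range (max N (n + 1)) :=
        Finset.range_mono (le_max_right _ _)
      rw [← Finset.sum_subset hsub]
      · refine Finset.sum_congr rfl fun i hi => ?_
        rw [if_pos (by simpa using hi)]
      · intro i _ hi
        rw [if_neg (by simpa using hi)]
        simp
    rw [e1, e2]

theorem isLeast_spectrumSeq_succ {m : ℕ} {q : ℝ} (hm : 1 ≤ m) (hq : 1 < q) (k : ℕ) :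
    IsLeast {y | y ∈ spectrumSet m q ∧ spectrumSeq m q k < y} (spectrumSeq m q (k + 1)) := by
  obtain ⟨y, hy, hky⟩ := exists_gt_mem_spectrumSet hm hq (spectrumSeq m q k)
  have hfin : {z | (z ∈ spectrumSet m q ∧ spectrumSeq m q k < z) ∧ z ≤ y}.Finite :=
    (finite_spectrumSet_le hq y).subset fun z hz => ⟨hz.1.1, hz.2⟩
  obtain ⟨a, ha, hmin⟩ := Set.exists_min_image _ id hfin ⟨y, ⟨hy, hky⟩, le_rfl⟩
  have hL : IsLeast {y | y ∈ spectrumSet m q ∧ spectrumSeq m q k < y} a := by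
    refine ⟨ha.1, fun z hz => ?_⟩
    rcases le_total z y with h | h
    · exact hmin z ⟨hz, h⟩
    · exact ha.2.trans h
  have : spectrumSeq m q (k + 1) = a := by
    rw [spectrumSeq]
    exact hL.csInf_eq
  rw [this]
  exact hL

theorem spectrumSeq_strictMono {m : ℕ} {q : ℝ} (hm : 1 ≤ m) (hq : 1 < q) :
    StrictMono (spectrumSeq m q) :=
  strictMono_nat_of_lt_succ fun k => (isLeast_spectrumSeq_succ hm hq k).1.2

theorem range_spectrumSeq {m : ℕ} {q : ℝ} (hm : 1 ≤ m) (hq : 1 < q) :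
    Set.range (spectrumSeq m q) = spectrumSet m q := by
  have hmem : ∀ k, spectrumSeq m q k ∈ spectrumSet m q := by
    intro k
    cases k with
    | zero => exact zero_mem_spectrumSet m q
    | succ k => exact (isLeast_spectrumSeq_succ hm hq k).1.1
  refine Set.Subset.antisymm (by rintro _ ⟨k, rfl⟩; exact hmem k) fun x hx => ?_
  by_contra hne
  have hlt : ∀ k, spectrumSeq m q k < x := by
    intro k
    induction k with
    | zero =>
      exact lt_of_le_of_ne (nonneg_of_mem_spectrumSet hq hx) fun h => hne ⟨0, h⟩
    | succ k ih =>
      exact lt_of_le_of_ne ((isLeast_spectrumSeq_succ hm hq k).2 ⟨hx, ih⟩)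
        fun h => hne ⟨k + 1, h⟩
  exact Set.infinite_of_injective_forall_mem (spectrumSeq_strictMono hm hq).injective
    (fun k => (⟨hmem k, (hlt k).le⟩ : spectrumSeq m q k ∈ {y | y ∈ spectrumSet m q ∧ y ≤ x}))
    (finite_spectrumSet_le hq x)

/-!
Write `q = √P`. The two smallest Pisot numbers need not be identified: the real root of
`X³ - X - 1` and the positive root of `X⁴ - X³ - 1` are Pisot numbers below `1.381`, so
`P < 1.381` and `q ^ 4 ≤ 2` (`IsSecondPisot.lt`).

**`-q` is a conjugate of `q`.** Otherwise `q` would be a Pisot number as well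
(`isPisot_of_isPisot_sq`), hence the only Pisot number below `P`. It is not the root of
`X³ - X - 1`, so `P` is at most that root and `q < 1.1515`. But `IsPisot.lt_of_isPisot` says that
there is no such Pisot number. Its proof follows Siegel: if `p` is the minimal polynomial of a Pisot
number `θ` and `p*` its reverse, then `F = p / p*` is a power series with integer coefficients `uₖ`,
and `(1 - θ X) F` is `X - θ` times a Blaschke product. Multiplication by a Blaschke factor does not
increase truncated sums of squares of coefficients, by a telescoping identity
(`sum_norm_sq_coeff_le_of_mul_eq`), so `u₀² + ∑ (uₖ₊₁ - θ uₖ)² ≤ 1 + θ²`. For `θ` close to `1` no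
integer sequence does this, except `±1, 0, 0, …`, which means `p = ± p*` and would make `θ + θ⁻¹` an
integer greater than `2`.

**Small differences.** Therefore `q a + q² b` determines `a, b ∈ X¹(q⁴)` (`powSum_eq_of_add_eq`). As
`q ^ 4 ≤ 2`, the set `X¹(q⁴)` has gaps at most `1`, so there are at least of the order of `m²` sums
`q a + q² b` in an interval of length `O(m)`; by the pigeonhole principle two sums of powers of `q`
with exponents `1` or `2` modulo `4` have an arbitrarily small nonzero difference
(`exists_powSum_sub_lt`).

**Small gaps.** Multiplying by powers of `q⁴` one obtains such differences between `ε / q⁴` and `ε`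
with supports as far out as desired. Switching them on one after the other gives chains of elements
of `X¹(q)` with steps at most `ε` and total length at least `1` (`exists_powSum_chain`), and adding
the elements of `X¹(q⁴)`, which use exponents divisible by `4` and have gaps at most `1`, gives
elements of `X¹(q)` within `ε` of every large number (`exists_spectrumSet_near`).
-/

/-! ### Sums of powers over finite sets of exponents -/

/-- The value `∑_{i ∈ E} q ^ i` of the polynomial with digits `0, 1` whose support is `E`. -/
noncomputable def powSum (q : ℝ) (E : Finset ℕ) : ℝ := ∑ i ∈ E, q ^ i

theorem powSum_empty (q : ℝ) : powSum q ∅ = 0 := by simp [powSum]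

theorem powSum_union (q : ℝ) {E F : Finset ℕ} (h : Disjoint E F) :
    powSum q (E ∪ F) = powSum q E + powSum q F := Finset.sum_union h

theorem powSum_nonneg {q : ℝ} (hq : 0 ≤ q) (E : Finset ℕ) : 0 ≤ powSum q E :=
  Finset.sum_nonneg fun i _ => pow_nonneg hq i

theorem powSum_image (q : ℝ) (E : Finset ℕ) {d : ℕ} (hd : d ≠ 0) (r : ℕ) :
    powSum q (E.image fun i => d * i + r) = q ^ r * powSum (q ^ d) E := by
  rw [powSum, Finset.sum_image fun i _ j _ h => ?_, powSum, Finset.mul_sum]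
  · exact Finset.sum_congr rfl fun i _ => by rw [pow_add, pow_mul, mul_comm]
  · exact Nat.eq_of_mul_eq_mul_left (by omega) (Nat.add_right_cancel h)

theorem powSum_mem_spectrumSet (q : ℝ) (E : Finset ℕ) : powSum q E ∈ spectrumSet 1 q := by
  refine ⟨E.sup id, fun i => if i ∈ E then 1 else 0, fun i => by dsimp only; split_ifs <;> omega, ?_⟩
  have hsub : E ⊆ Finset.range (E.sup id + 1) := fun i hi => by
    simpa [Nat.lt_succ_iff] using Finset.le_sup (f := id) hi
  rw [powSum, ← Finset.sum_subset hsub]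
  · exact Finset.sum_congr rfl fun i hi => by simp [hi]
  · intro i _ hi
    simp [hi]

/-- For `1 ≤ Q ≤ 2` the sums `powSum Q E` with `E ⊆ {0, …, n - 1}` leave no gap longer than `1`
below their maximum. -/
theorem exists_powSum_range_near {Q : ℝ} (h1 : 1 ≤ Q) (h2 : Q ≤ 2) (n : ℕ) :
    ∀ t : ℝ, 0 ≤ t → t ≤ powSum Q (Finset.range n) →
      ∃ E ⊆ Finset.range n, powSum Q E ≤ t ∧ t ≤ powSum Q E + 1 := by
  induction n with
  | zero =>
    intro t h0 ht
    refine ⟨∅, by simp, ?_⟩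
    simp [powSum] at ht ⊢
    constructor <;> linarith
  | succ n ih =>
    intro t h0 ht
    have hS : powSum Q (Finset.range (n + 1)) = powSum Q (Finset.range n) + Q ^ n :=
      Finset.sum_range_succ _ _
    have hsub : Finset.range n ⊆ Finset.range (n + 1) := Finset.range_mono (Nat.le_succ n)
    rcases le_or_gt (Q ^ n) t with h | h
    · obtain ⟨E, hE, h3, h4⟩ := ih (t - Q ^ n) (by linarith) (by linarith)
      have hn : n ∉ E := fun hn => by simpa using hE hn
      have : powSum Q (insert n E) = Q ^ n + powSum Q E := Finset.sum_insert hn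
      refine ⟨insert n E, Finset.insert_subset (by simp) (hE.trans hsub), ?_, ?_⟩ <;> linarith
    · rcases le_or_gt t (powSum Q (Finset.range n)) with h5 | h5
      · obtain ⟨E, hE, h3, h4⟩ := ih t h0 h5
        exact ⟨E, hE.trans hsub, h3, h4⟩
      · refine ⟨Finset.range n, hsub, h5.le, ?_⟩
        -- `Q ^ n = 1 + (Q - 1) (1 + Q + ⋯ + Q ^ (n - 1)) ≤ 1 + (1 + Q + ⋯ + Q ^ (n - 1))`
        have hg : powSum Q (Finset.range n) * (Q - 1) = Q ^ n - 1 := geom_sum_mul Q n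
        have := powSum_nonneg (by linarith : 0 ≤ Q) (Finset.range n)
        nlinarith

theorem natCast_le_powSum_range {Q : ℝ} (h1 : 1 ≤ Q) (n : ℕ) :
    (n : ℝ) ≤ powSum Q (Finset.range n) := by
  have : ∑ _i ∈ Finset.range n, (1 : ℝ) ≤ ∑ i ∈ Finset.range n, Q ^ i :=
    Finset.sum_le_sum fun i _ => one_le_pow₀ h1
  simpa [powSum] using this

theorem exists_powSum_near {Q : ℝ} (h1 : 1 ≤ Q) (h2 : Q ≤ 2) (t : ℝ) (h0 : 0 ≤ t) :
    ∃ E : Finset ℕ, powSum Q E ≤ t ∧ t ≤ powSum Q E + 1 := by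
  obtain ⟨n, hn⟩ := exists_nat_ge t
  obtain ⟨E, -, h⟩ := exists_powSum_range_near h1 h2 n t h0
    (hn.trans (natCast_le_powSum_range h1 n))
  exact ⟨E, h⟩

/-! ### Small differences of sums of powers -/

/-- If `q a + q² b` determines `a, b ∈ X¹(q⁴)` then, as `X¹(q⁴)` has at least `m + 1` elements in
`[0, 2m]`, there are at least `(m + 1)²` sums `q a + q² b` in an interval of length `O(m)`, and two
of them are close. -/
theorem exists_powSum_sub_lt {q : ℝ} (h1 : 1 < q) (h2 : q ^ 4 ≤ 2)
    (hind : ∀ A A' B B' : Finset ℕ,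
      q * powSum (q ^ 4) A + q ^ 2 * powSum (q ^ 4) B
        = q * powSum (q ^ 4) A' + q ^ 2 * powSum (q ^ 4) B' →
      powSum (q ^ 4) A = powSum (q ^ 4) A' ∧ powSum (q ^ 4) B = powSum (q ^ 4) B')
    {ε : ℝ} (hε : 0 < ε) :
    ∃ E F : Finset ℕ, (∀ i ∈ E, i % 4 = 1 ∨ i % 4 = 2) ∧ (∀ i ∈ F, i % 4 = 1 ∨ i % 4 = 2) ∧
      0 < powSum q E - powSum q F ∧ powSum q E - powSum q F < ε := by
  have hQ : 1 ≤ q ^ 4 := one_le_pow₀ h1.le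
  have hq2 : q ^ 2 ≤ 2 := by nlinarith [one_le_pow₀ h1.le (n := 2)]
  have hqq : q ≤ 2 := by nlinarith
  choose! X hX using fun t : ℝ => exists_powSum_near hQ h2 t
  set x : ℕ → ℝ := fun j => powSum (q ^ 4) (X (2 * j)) with hx
  have hx1 (j : ℕ) : x j ≤ 2 * j ∧ 2 * j ≤ x j + 1 := hX (2 * j) (by positivity)
  have hx0 (j : ℕ) : 0 ≤ x j := powSum_nonneg (by positivity) _
  have hxinj : ∀ j k : ℕ, x j = x k → j = k := by
    intro j k h
    have hj := hx1 j
    have hk := hx1 k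
    rw [h] at hj
    have a1 : (2 * j : ℝ) ≤ 2 * k + 1 := by linarith
    have a2 : (2 * k : ℝ) ≤ 2 * j + 1 := by linarith
    have b1 : 2 * j ≤ 2 * k + 1 := by exact_mod_cast a1
    have b2 : 2 * k ≤ 2 * j + 1 := by exact_mod_cast a2
    omega
  obtain ⟨m, hm⟩ := exists_nat_ge (8 / ε)
  have hm' : 8 ≤ m * ε := by rwa [div_le_iff₀ hε] at hm
  let v : ℕ × ℕ → ℝ := fun p => q * x p.1 + q ^ 2 * x p.2
  have hv0 (p) : 0 ≤ v p := by have := hx0 p.1; have := hx0 p.2; positivity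
  have hmaps : ∀ p ∈ Finset.range (m + 1) ×ˢ Finset.range (m + 1),
      ⌊v p / ε⌋₊ ∈ Finset.range (m ^ 2 + 1) := by
    rintro ⟨j, k⟩ hp
    rw [Finset.mem_product, Finset.mem_range, Finset.mem_range] at hp
    have hj : (j : ℝ) ≤ m := by exact_mod_cast Nat.lt_succ_iff.1 hp.1
    have hk : (k : ℝ) ≤ m := by exact_mod_cast Nat.lt_succ_iff.1 hp.2
    have e1 : q * x j ≤ 2 * (2 * m) :=
      mul_le_mul hqq (by linarith [hx1 j]) (hx0 j) (by norm_num)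
    have e2 : q ^ 2 * x k ≤ 2 * (2 * m) :=
      mul_le_mul hq2 (by linarith [hx1 k]) (hx0 k) (by norm_num)
    have e3 : v (j, k) / ε ≤ ((m ^ 2 : ℕ) : ℝ) := by
      rw [div_le_iff₀ hε]
      push_cast
      have : (0 : ℝ) ≤ m := by positivity
      show q * x j + q ^ 2 * x k ≤ _
      nlinarith
    have := Nat.floor_le_floor e3
    rw [Nat.floor_natCast] at this
    rw [Finset.mem_range]
    omega
  have hcard : (Finset.range (m ^ 2 + 1)).card
      < (Finset.range (m + 1) ×ˢ Finset.range (m + 1)).card := by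
    have hmpos : 0 < m := by
      rcases Nat.eq_zero_or_pos m with h | h
      · subst h
        norm_num at hm'
      · exact h
    simp only [Finset.card_range, Finset.card_product]
    nlinarith
  obtain ⟨p, -, p', -, hne, hfl⟩ := Finset.exists_ne_map_eq_of_card_lt_of_maps_to hcard hmaps
  have hlt : |v p - v p'| < ε := by
    have a := Nat.floor_le (div_nonneg (hv0 p) hε.le)
    have b := Nat.lt_floor_add_one (v p / ε)
    have a' := Nat.floor_le (div_nonneg (hv0 p') hε.le)
    have b' := Nat.lt_floor_add_one (v p' / ε)
    rw [hfl] at a b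
    have c : |v p / ε - v p' / ε| < 1 := by rw [abs_lt]; constructor <;> linarith
    rw [← sub_div, abs_div, abs_of_pos hε, div_lt_one hε] at c
    exact c
  have hvne : v p ≠ v p' := by
    intro h
    obtain ⟨ha, hb⟩ := hind _ _ _ _ h
    exact hne (Prod.ext (hxinj _ _ ha) (hxinj _ _ hb))
  -- `v p` is the sum over the exponents `4 i + 1`, `i ∈ X (2 p.1)`, and `4 i + 2`, `i ∈ X (2 p.2)`
  have hval : ∀ p : ℕ × ℕ, ∃ E : Finset ℕ, (∀ i ∈ E, i % 4 = 1 ∨ i % 4 = 2) ∧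
      powSum q E = v p := by
    intro p
    refine ⟨(X (2 * p.1)).image (fun i => 4 * i + 1) ∪ (X (2 * p.2)).image (fun i => 4 * i + 2),
      ?_, ?_⟩
    · intro i hi
      simp only [Finset.mem_union, Finset.mem_image] at hi
      rcases hi with ⟨b, -, rfl⟩ | ⟨b, -, rfl⟩ <;> omega
    · rw [powSum_union, powSum_image _ _ (by norm_num), powSum_image _ _ (by norm_num), pow_one]
      rw [Finset.disjoint_left]
      intro i hi hi'
      simp only [Finset.mem_image] at hi hi'
      obtain ⟨b, -, rfl⟩ := hi
      obtain ⟨b', -, h⟩ := hi'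
      omega
  obtain ⟨E, hE, hEv⟩ := hval p
  obtain ⟨F, hF, hFv⟩ := hval p'
  rw [abs_lt] at hlt
  rcases lt_or_gt_of_ne hvne with h | h
  · exact ⟨F, E, hF, hE, by linarith, by linarith⟩
  · exact ⟨E, F, hE, hF, by linarith, by linarith⟩

/-- Multiplication by powers of `q⁴` moves a small difference to arbitrarily high exponents, and
then brings it into the range from `ε / q⁴` to `ε`. -/
theorem exists_powSum_sub_mem_Icc {q : ℝ} (h1 : 1 < q)
    (hsmall : ∀ ε : ℝ, 0 < ε → ∃ E F : Finset ℕ, (∀ i ∈ E, i % 4 = 1 ∨ i % 4 = 2) ∧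
      (∀ i ∈ F, i % 4 = 1 ∨ i % 4 = 2) ∧
      0 < powSum q E - powSum q F ∧ powSum q E - powSum q F < ε)
    {ε : ℝ} (hε : 0 < ε) (M : ℕ) :
    ∃ E F : Finset ℕ, (∀ i ∈ E, M ≤ i ∧ (i % 4 = 1 ∨ i % 4 = 2)) ∧
      (∀ i ∈ F, M ≤ i ∧ (i % 4 = 1 ∨ i % 4 = 2)) ∧
      ε / q ^ 4 ≤ powSum q E - powSum q F ∧ powSum q E - powSum q F ≤ ε := by
  have hQ : 1 < q ^ 4 := one_lt_pow₀ h1 (by norm_num)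
  have hMpos : 0 < (q ^ 4) ^ M := by positivity
  obtain ⟨E, F, hE, hF, h0, hlt⟩ := hsmall (ε / (q ^ 4) ^ M) (by positivity)
  rw [lt_div_iff₀ hMpos] at hlt
  set y := powSum q E - powSum q F with hy
  have hy' : 0 < y * (q ^ 4) ^ M := by positivity
  obtain ⟨n, hn1, hn2⟩ := exists_nat_pow_near (x := ε / (y * (q ^ 4) ^ M))
    ((one_le_div hy').2 hlt.le) hQ
  rw [le_div_iff₀ hy'] at hn1
  rw [div_lt_iff₀ hy'] at hn2
  have hval : powSum q (E.image fun i => 1 * i + 4 * (M + n))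
      - powSum q (F.image fun i => 1 * i + 4 * (M + n)) = (q ^ 4) ^ n * (y * (q ^ 4) ^ M) := by
    rw [powSum_image _ _ one_ne_zero, powSum_image _ _ one_ne_zero, pow_one, ← mul_sub, ← hy,
      pow_mul, pow_add]
    ring
  refine ⟨_, _, ?_, ?_, ?_, hval.le.trans hn1⟩
  · intro i hi
    obtain ⟨j, hj, rfl⟩ := Finset.mem_image.1 hi
    have := hE j hj
    omega
  · intro i hi
    obtain ⟨j, hj, rfl⟩ := Finset.mem_image.1 hi
    have := hF j hj
    omega
  · rw [hval, div_le_iff₀ (by positivity)]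
    refine hn2.le.trans (le_of_eq ?_)
    ring

/-- Small differences `powSum q E - powSum q F` with disjoint supports can be switched on one after
the other: their partial sums form a chain with steps at most `ε`, as long as desired. -/
theorem exists_powSum_chain {q : ℝ} (h1 : 1 < q) {ε : ℝ} (hε : 0 < ε)
    (hmid : ∀ M : ℕ, ∃ E F : Finset ℕ, (∀ i ∈ E, M ≤ i ∧ (i % 4 = 1 ∨ i % 4 = 2)) ∧
      (∀ i ∈ F, M ≤ i ∧ (i % 4 = 1 ∨ i % 4 = 2)) ∧
      ε / q ^ 4 ≤ powSum q E - powSum q F ∧ powSum q E - powSum q F ≤ ε) (N : ℕ) :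
    ∃ (M : ℕ) (c Y : ℝ), N * (ε / q ^ 4) ≤ Y ∧
      (∃ E : Finset ℕ, (∀ i ∈ E, i < M ∧ (i % 4 = 1 ∨ i % 4 = 2)) ∧ powSum q E = c + Y) ∧
      ∀ t : ℝ, 0 ≤ t → t ≤ Y → ∃ E : Finset ℕ, (∀ i ∈ E, i < M ∧ (i % 4 = 1 ∨ i % 4 = 2)) ∧
        powSum q E ≤ c + t ∧ c + t ≤ powSum q E + ε := by
  induction N with
  | zero =>
    refine ⟨0, 0, 0, by simp, ⟨∅, by simp, by simp [powSum]⟩, fun t h0 ht => ⟨∅, by simp, ?_⟩⟩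
    rw [powSum_empty]
    constructor <;> linarith
  | succ N ih =>
    obtain ⟨M, c, Y, hY, ⟨T, hT, hTv⟩, hcov⟩ := ih
    obtain ⟨E₀, F₀, hE₀, hF₀, hl, hu⟩ := hmid M
    have hb : ∃ M', M ≤ M' ∧ (∀ i ∈ E₀, i < M') ∧ ∀ i ∈ F₀, i < M' := by
      refine ⟨M + (E₀ ∪ F₀).sup id + 1, by omega, fun i hi => ?_, fun i hi => ?_⟩
      · have : id i ≤ (E₀ ∪ F₀).sup id := Finset.le_sup (Finset.mem_union_left _ hi)
        simp only [id] at this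
        omega
      · have : id i ≤ (E₀ ∪ F₀).sup id := Finset.le_sup (Finset.mem_union_right _ hi)
        simp only [id] at this
        omega
    obtain ⟨M', hMM, hEM, hFM⟩ := hb
    have hdisj : ∀ E G : Finset ℕ, (∀ i ∈ E, i < M ∧ (i % 4 = 1 ∨ i % 4 = 2)) →
        (∀ i ∈ G, M ≤ i ∧ (i % 4 = 1 ∨ i % 4 = 2)) → (∀ i ∈ G, i < M') →
        powSum q (E ∪ G) = powSum q E + powSum q G ∧
          ∀ i ∈ E ∪ G, i < M' ∧ (i % 4 = 1 ∨ i % 4 = 2) := by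
      intro E G hE hG hG'
      refine ⟨powSum_union q (Finset.disjoint_left.2 fun i hi hi' => ?_), fun i hi => ?_⟩
      · have := (hE i hi).1
        have := (hG i hi').1
        omega
      · rcases Finset.mem_union.1 hi with h | h
        · exact ⟨(hE i h).1.trans_le hMM, (hE i h).2⟩
        · exact ⟨hG' i h, (hG i h).2⟩
    have hε' : 0 ≤ ε / q ^ 4 := by positivity
    have hN : (0 : ℝ) ≤ N * (ε / q ^ 4) := by positivity
    refine ⟨M', c + powSum q F₀, Y + (powSum q E₀ - powSum q F₀), ?_, ?_, fun t h0 ht => ?_⟩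
    · push_cast
      linarith
    · obtain ⟨hs, hm⟩ := hdisj T E₀ hT hE₀ hEM
      exact ⟨T ∪ E₀, hm, by rw [hs]; linarith⟩
    · rcases le_or_gt t Y with h | h
      · obtain ⟨E, hE, h3, h4⟩ := hcov t h0 h
        obtain ⟨hs, hm⟩ := hdisj E F₀ hE hF₀ hFM
        exact ⟨E ∪ F₀, hm, by rw [hs]; linarith, by rw [hs]; linarith⟩
      · obtain ⟨hs, hm⟩ := hdisj T F₀ hT hF₀ hFM
        exact ⟨T ∪ F₀, hm, by rw [hs]; linarith, by rw [hs]; linarith⟩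

/-- Combining the chain of small differences, which uses exponents not divisible by `4`, with the
sums `powSum (q ^ 4) G`, whose gaps are at most `1`. -/
theorem exists_spectrumSet_near {q : ℝ} (h1 : 1 < q) (h2 : q ^ 4 ≤ 2)
    (hsmall : ∀ ε : ℝ, 0 < ε → ∃ E F : Finset ℕ, (∀ i ∈ E, i % 4 = 1 ∨ i % 4 = 2) ∧
      (∀ i ∈ F, i % 4 = 1 ∨ i % 4 = 2) ∧
      0 < powSum q E - powSum q F ∧ powSum q E - powSum q F < ε)
    {ε : ℝ} (hε : 0 < ε) :
    ∃ c : ℝ, ∀ x : ℝ, c ≤ x → ∃ z ∈ spectrumSet 1 q, z ≤ x ∧ x ≤ z + ε := by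
  have hpos : 0 < ε / q ^ 4 := by positivity
  obtain ⟨N, hN⟩ := exists_nat_ge (1 / (ε / q ^ 4))
  rw [div_le_iff₀ hpos] at hN
  obtain ⟨M, c, Y, hY, -, hcov⟩ :=
    exists_powSum_chain h1 hε (exists_powSum_sub_mem_Icc h1 hsmall hε) N
  refine ⟨c, fun x hx => ?_⟩
  obtain ⟨G, hG1, hG2⟩ := exists_powSum_near (one_le_pow₀ h1.le) h2 (x - c) (by linarith)
  obtain ⟨E, hE, hE1, hE2⟩ := hcov (x - c - powSum (q ^ 4) G) (by linarith) (by linarith)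
  have hG : powSum q (G.image fun i => 4 * i + 0) = powSum (q ^ 4) G := by
    rw [powSum_image q G (by norm_num), pow_zero, one_mul]
  rw [← hG] at hE1 hE2
  refine ⟨_, powSum_mem_spectrumSet q (E ∪ G.image fun i => 4 * i + 0), ?_, ?_⟩
  all_goals
    rw [powSum_union]
    · linarith
    · rw [Finset.disjoint_left]
      intro i hi hi'
      obtain ⟨b, -, rfl⟩ := Finset.mem_image.1 hi'
      have := (hE _ hi).2
      omega

theorem bigL_eq_zero_of_near {m : ℕ} {q : ℝ} (hm : 1 ≤ m) (h1 : 1 < q)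
    (h : ∀ ε : ℝ, 0 < ε → ∃ c : ℝ, ∀ x : ℝ, c ≤ x →
      ∃ z ∈ spectrumSet m q, z ≤ x ∧ x ≤ z + ε) :
    bigL m q = 0 := by
  have hlim : Filter.Tendsto (fun k => spectrumSeq m q (k + 1) - spectrumSeq m q k)
      Filter.atTop (nhds 0) := by
    rw [Metric.tendsto_atTop]
    intro ε hε
    obtain ⟨c, hc⟩ := h (ε / 3) (by positivity)
    obtain ⟨y, hy, hcy⟩ := exists_gt_mem_spectrumSet hm h1 c
    rw [← range_spectrumSeq hm h1] at hy
    obtain ⟨K, rfl⟩ := hy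
    refine ⟨K, fun k hk => ?_⟩
    have hck : c < spectrumSeq m q k :=
      hcy.trans_le ((spectrumSeq_strictMono hm h1).monotone hk)
    -- an element of the spectrum between `x_k + ε / 3` and `x_k + 2 ε / 3`
    obtain ⟨z, hz, hz1, hz2⟩ := hc (spectrumSeq m q k + 2 * (ε / 3)) (by linarith)
    have hle := (isLeast_spectrumSeq_succ hm h1 k).2 ⟨hz, by linarith⟩
    have hlt := spectrumSeq_strictMono hm h1 (Nat.lt_succ_self k)
    rw [Real.dist_eq, sub_zero, abs_of_pos (by simpa using hlt)]
    linarith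
  exact ((continuous_coe_real_ereal.tendsto 0).comp hlim).limsup_eq

/-! ### Two Pisot numbers below `√2` -/

theorem isPisot_of_polynomial {θ : ℝ} (h1 : 1 < θ) (p : Polynomial ℤ) (hp : p.Monic)
    (hθ : Polynomial.aeval θ p = 0)
    (hroot : ∀ z : ℂ, Polynomial.aeval z p = 0 → z ≠ θ → ‖z‖ < 1) : IsPisot θ := by
  refine ⟨h1, ⟨p, hp, hθ⟩, fun z hz hne => hroot z ?_ hne⟩
  have hd : minpoly ℚ θ ∣ p.map (algebraMap ℤ ℚ) :=
    minpoly.dvd _ _ (by rw [Polynomial.aeval_map_algebraMap, hθ])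
  obtain ⟨r, hr⟩ := hd
  rw [← Polynomial.aeval_map_algebraMap ℚ, hr, map_mul, hz, zero_mul]

/-- A complex root of a real quadratic polynomial with negative discriminant has squared modulus
equal to the constant coefficient. -/
theorem norm_lt_one_of_quadratic {s t : ℝ} (hd : s ^ 2 < 4 * t) (ht : t < 1) {z : ℂ}
    (hz : z ^ 2 + s * z + t = 0) : ‖z‖ < 1 := by
  have hre := congrArg Complex.re hz
  have him := congrArg Complex.im hz
  simp [pow_two] at hre him
  have him' : z.im * (2 * z.re + s) = 0 := by linarith
  have hsq : ‖z‖ ^ 2 = z.re ^ 2 + z.im ^ 2 := by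
    rw [← Complex.normSq_eq_norm_sq, Complex.normSq_apply]
    ring
  rcases mul_eq_zero.1 him' with h | h
  · rw [h] at hre
    nlinarith [sq_nonneg (2 * z.re + s)]
  · have : ‖z‖ ^ 2 = t := by
      rw [hsq]
      linear_combination z.re * h - hre
    nlinarith [norm_nonneg z]

/-- The real root of `X³ - X - 1` is a Pisot number. -/
theorem exists_isPisot_cubic : ∃ θ : ℝ, IsPisot θ ∧ 1.324 < θ ∧ θ < 1.325 := by
  have hc : ContinuousOn (fun x : ℝ => x ^ 3 - x - 1) (Set.Icc 1.324 1.325) := by fun_prop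
  obtain ⟨θ, ⟨hl, hu⟩, hθ⟩ := intermediate_value_Ioo (by norm_num) hc
    (show (0 : ℝ) ∈ Set.Ioo _ _ by constructor <;> norm_num)
  simp only at hθ
  refine ⟨θ, isPisot_of_polynomial (by linarith)
    (Polynomial.X ^ 3 - Polynomial.X - 1) (by monicity!) (by simpa using hθ) ?_, hl, hu⟩
  intro z hz hne
  simp only [map_sub, map_pow, Polynomial.aeval_X, map_one] at hz
  have hθ' : (θ : ℂ) ^ 3 - θ - 1 = 0 := by exact_mod_cast hθ
  refine norm_lt_one_of_quadratic (s := θ) (t := θ ^ 2 - 1) (by nlinarith) (by nlinarith) ?_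
  apply mul_left_cancel₀ (sub_ne_zero.2 hne)
  push_cast
  linear_combination hz - hθ'

/-- The positive root of `X⁴ - X³ - 1` is a Pisot number. -/
theorem exists_isPisot_quartic : ∃ θ : ℝ, IsPisot θ ∧ 1.38 < θ ∧ θ < 1.381 := by
  have hc (a b : ℝ) : ContinuousOn (fun x : ℝ => x ^ 4 - x ^ 3 - 1) (Set.Icc a b) := by fun_prop
  obtain ⟨θ, ⟨hl, hu⟩, hθ⟩ := intermediate_value_Ioo (by norm_num) (hc 1.38 1.381)
    (show (0 : ℝ) ∈ Set.Ioo _ _ by constructor <;> norm_num)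
  -- the polynomial has a second real root `β`, and then a quadratic cofactor
  obtain ⟨β, ⟨hl', hu'⟩, hβ⟩ := intermediate_value_Ioo' (by norm_num) (hc (-0.82) (-0.81))
    (show (0 : ℝ) ∈ Set.Ioo _ _ by constructor <;> norm_num)
  simp only at hθ hβ
  refine ⟨θ, isPisot_of_polynomial (by linarith)
    (Polynomial.X ^ 4 - Polynomial.X ^ 3 - 1) (by monicity!) (by simpa using hθ) ?_, hl, hu⟩
  intro z hz hne
  simp only [map_sub, map_pow, Polynomial.aeval_X, map_one] at hz
  by_cases hzβ : z = β
  · rw [hzβ, Complex.norm_real, Real.norm_eq_abs, abs_lt]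
    constructor <;> linarith
  have hθ' : (θ : ℂ) ^ 4 - θ ^ 3 - 1 = 0 := by exact_mod_cast hθ
  have hβ' : (β : ℂ) ^ 4 - β ^ 3 - 1 = 0 := by exact_mod_cast hβ
  have hθβ : (θ : ℂ) - β ≠ 0 := by
    have : θ - β ≠ 0 := by linarith
    exact_mod_cast this
  refine norm_lt_one_of_quadratic (s := θ + β - 1)
    (t := θ ^ 2 + θ * β + β ^ 2 - θ - β) (by nlinarith) (by nlinarith) ?_
  apply mul_left_cancel₀ (mul_ne_zero (mul_ne_zero (sub_ne_zero.2 hne) (sub_ne_zero.2 hzβ)) hθβ)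
  push_cast
  -- divided differences of `X⁴ - X³ - 1` at `z`, `θ`, `β`
  linear_combination (θ - β) * hz + (β - z) * hθ' + (z - θ) * hβ'

/-! ### Multiplication by Blaschke factors contracts truncated sums of squares -/

theorem sum_norm_sq_coeff_le_of_mul_eq {α : ℂ} (hα : ‖α‖ ≤ 1) {g h : PowerSeries ℂ}
    (hgh : g * (1 - PowerSeries.C (starRingEnd ℂ α) * PowerSeries.X)
      = h * (PowerSeries.X - PowerSeries.C α)) (N : ℕ) :
    ∑ k ∈ Finset.range N, ‖PowerSeries.coeff k g‖ ^ 2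
      ≤ ∑ k ∈ Finset.range N, ‖PowerSeries.coeff k h‖ ^ 2 := by
  set β := starRingEnd ℂ α with hβ
  set d : PowerSeries ℂ := 1 - PowerSeries.C β * PowerSeries.X with hd
  have hd0 : PowerSeries.constantCoeff d ≠ 0 := by simp [hd]
  have hdne : d ≠ 0 := fun h0 => hd0 (by rw [h0, map_zero])
  -- in terms of `w = h / (1 - ᾱ X)` the difference of the squares telescopes
  obtain ⟨w, hw⟩ : ∃ w, h = w * d :=
    ⟨h * d⁻¹, by rw [mul_assoc, PowerSeries.inv_mul_cancel _ hd0, mul_one]⟩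
  have hg : g = w * (PowerSeries.X - PowerSeries.C α) := by
    apply mul_right_cancel₀ hdne
    rw [hgh, hw]
    ring
  have hh0 : PowerSeries.coeff 0 h = PowerSeries.coeff 0 w := by
    simp [hw, hd]
  have hg0 : PowerSeries.coeff 0 g = - α * PowerSeries.coeff 0 w := by
    simp [hg, mul_comm]
  have hhs (k : ℕ) : PowerSeries.coeff (k + 1) h
      = PowerSeries.coeff (k + 1) w - β * PowerSeries.coeff k w := by
    rw [hw, hd, mul_sub, mul_one, map_sub, mul_left_comm, PowerSeries.coeff_C_mul,
      PowerSeries.coeff_succ_mul_X]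
  have hgs (k : ℕ) : PowerSeries.coeff (k + 1) g
      = PowerSeries.coeff k w - α * PowerSeries.coeff (k + 1) w := by
    rw [hg, mul_sub, map_sub, mul_comm w (PowerSeries.C α), PowerSeries.coeff_C_mul,
      PowerSeries.coeff_succ_mul_X]
  have hstep (a b : ℂ) : ‖b - β * a‖ ^ 2 - ‖a - α * b‖ ^ 2
      = (1 - ‖α‖ ^ 2) * (‖b‖ ^ 2 - ‖a‖ ^ 2) := by
    simp only [← Complex.normSq_eq_norm_sq, Complex.normSq_apply, Complex.sub_re, Complex.sub_im,
      Complex.mul_re, Complex.mul_im, hβ, Complex.conj_re, Complex.conj_im]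
    ring
  have htel : ∀ n : ℕ, ∑ k ∈ Finset.range (n + 1), ‖PowerSeries.coeff k h‖ ^ 2
      - ∑ k ∈ Finset.range (n + 1), ‖PowerSeries.coeff k g‖ ^ 2
      = (1 - ‖α‖ ^ 2) * ‖PowerSeries.coeff n w‖ ^ 2 := by
    intro n
    induction n with
    | zero =>
      rw [Finset.sum_range_one, Finset.sum_range_one, hh0, hg0, norm_mul, norm_neg]
      ring
    | succ n ih =>
      rw [Finset.sum_range_succ, Finset.sum_range_succ _ (n + 1), hhs, hgs]
      linear_combination ih + hstep (PowerSeries.coeff n w) (PowerSeries.coeff (n + 1) w)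
  cases N with
  | zero => simp
  | succ n =>
    have := htel n
    have h1 : 0 ≤ 1 - ‖α‖ ^ 2 := by nlinarith [norm_nonneg α]
    have := mul_nonneg h1 (sq_nonneg ‖PowerSeries.coeff n w‖)
    linarith

theorem sum_norm_sq_coeff_le_of_mul_prod_eq (S : Multiset ℂ) (hS : ∀ α ∈ S, ‖α‖ ≤ 1)
    {g h : PowerSeries ℂ}
    (hgh : g * (S.map fun α => 1 - PowerSeries.C (starRingEnd ℂ α) * PowerSeries.X).prod
      = h * (S.map fun α => PowerSeries.X - PowerSeries.C α).prod) (N : ℕ) :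
    ∑ k ∈ Finset.range N, ‖PowerSeries.coeff k g‖ ^ 2
      ≤ ∑ k ∈ Finset.range N, ‖PowerSeries.coeff k h‖ ^ 2 := by
  induction S using Multiset.induction_on generalizing h with
  | empty =>
    simp only [Multiset.map_zero, Multiset.prod_zero, mul_one] at hgh
    rw [hgh]
  | cons α S ih =>
    rw [Multiset.map_cons, Multiset.prod_cons, Multiset.map_cons, Multiset.prod_cons] at hgh
    set d : PowerSeries ℂ := 1 - PowerSeries.C (starRingEnd ℂ α) * PowerSeries.X with hd
    have hd0 : PowerSeries.constantCoeff d ≠ 0 := by simp [hd]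
    have hdne : d ≠ 0 := fun h0 => hd0 (by rw [h0, map_zero])
    have hinv := PowerSeries.mul_inv_cancel _ hd0
    refine (ih (fun β hβ => hS β (Multiset.mem_cons_of_mem hβ))
      (h := h * (PowerSeries.X - PowerSeries.C α) * d⁻¹) ?_).trans
      (sum_norm_sq_coeff_le_of_mul_eq (hS α (Multiset.mem_cons_self α S)) ?_ N)
    · apply mul_left_cancel₀ hdne
      linear_combination hgh - h * (PowerSeries.X - PowerSeries.C α) *
        (S.map fun α => PowerSeries.X - PowerSeries.C α).prod * hinv
    · linear_combination h * (PowerSeries.X - PowerSeries.C α) * hinv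

/-! ### Integer sequences close to geometric progressions of small ratio -/

/-- An integer sequence that starts with `1` and has small total deviation from a geometric
progression of ratio `θ` close to `1` must drop to `0` at once: it cannot stay at `1` or at `2`
forever, and the steps `1 → 2`, `2 → 3` and whatever follows `3` deviate too much altogether. -/
theorem eq_zero_of_sum_sq_sub_mul_le {θ : ℝ} (h1 : 1 < θ) (h2 : θ ≤ 1.1515) {u : ℕ → ℤ}
    (hu : u 0 = 1)
    (hsum : ∀ N : ℕ, ∑ k ∈ Finset.range N, ((u (k + 1) : ℝ) - θ * u k) ^ 2 ≤ θ ^ 2) (k : ℕ) :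
    u (k + 1) = 0 := by
  set c : ℕ → ℝ := fun k => ((u (k + 1) : ℝ) - θ * u k) ^ 2 with hc
  have hc0 (k : ℕ) : 0 ≤ c k := sq_nonneg _
  have hlim := (summable_of_sum_range_le hc0 hsum).tendsto_atTop_zero
  have hfin (s : Finset ℕ) : ∑ k ∈ s, c k ≤ θ ^ 2 := by
    refine le_trans (Finset.sum_le_sum_of_subset_of_nonneg (t := Finset.range (s.sup id + 1))
      (fun i hi => ?_) fun i _ _ => hc0 i) (hsum _)
    simpa [Nat.lt_succ_iff] using Finset.le_sup (f := id) hi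
  have hpair {i j : ℕ} (hij : i ≠ j) : c i + c j ≤ θ ^ 2 := by
    simpa [Finset.sum_pair hij] using hfin {i, j}
  -- the sequence leaves every nonzero value
  have hleave (n : ℤ) (hn : n ≠ 0) (K : ℕ) (hK : u K = n) :
      ∃ k, K ≤ k ∧ u k = n ∧ u (k + 1) ≠ n := by
    by_contra! hcon
    have hconst : ∀ k, K ≤ k → u k = n := fun k hk =>
      Nat.le_induction hK (fun k hk ih => hcon k hk ih) k hk
    have hlim' : Filter.Tendsto c Filter.atTop (nhds (((n : ℝ) - θ * n) ^ 2)) := by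
      refine tendsto_const_nhds.congr' ?_
      filter_upwards [Filter.eventually_ge_atTop K] with k hk
      simp only [hc, hconst k hk, hconst (k + 1) (by omega)]
    have h0 := tendsto_nhds_unique hlim' hlim
    have hn' : (n : ℝ) ≠ 0 := by exact_mod_cast hn
    have : (n : ℝ) * (1 - θ) = 0 := by
      have := pow_eq_zero_iff (two_ne_zero) |>.1 h0
      linarith
    rcases mul_eq_zero.1 this with h | h
    · exact hn' h
    · linarith
  obtain ⟨k₁, -, hk₁, hk₁'⟩ := hleave 1 one_ne_zero 0 hu
  have hc₁ : c k₁ = ((u (k₁ + 1) : ℝ) - θ) ^ 2 := by simp [hc, hk₁]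
  have hle₁ : c k₁ ≤ θ ^ 2 := by simpa using hfin {k₁}
  have hv0 : 0 ≤ u (k₁ + 1) := by
    by_contra! h
    have : (u (k₁ + 1) : ℝ) ≤ -1 := by exact_mod_cast Int.le_sub_one_of_lt h
    nlinarith
  have hv2 : u (k₁ + 1) ≤ 2 := by
    by_contra! h
    have : (3 : ℝ) ≤ u (k₁ + 1) := by exact_mod_cast h
    nlinarith
  obtain hv | hv : u (k₁ + 1) = 0 ∨ u (k₁ + 1) = 2 := by omega
  · -- the step `1 → 0` uses up all the admissible deviation, so there is no other deviation
    have hc₁' : c k₁ = θ ^ 2 := by rw [hc₁, hv]; simp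
    have hrest (j : ℕ) (hj : j ≠ k₁) : (u (j + 1) : ℝ) - θ * u j = 0 := by
      have := hpair hj
      have : c j = 0 := le_antisymm (by linarith) (hc0 j)
      exact pow_eq_zero_iff (two_ne_zero) |>.1 this
    have hk0 : k₁ = 0 := by
      by_contra hne
      have h0 := hrest 0 (Ne.symm hne)
      rw [hu, Int.cast_one, mul_one] at h0
      have ha : (1 : ℝ) < u (0 + 1) := by linarith
      have hb : (u (0 + 1) : ℝ) < 2 := by linarith
      have ha' : 1 < u (0 + 1) := by exact_mod_cast ha
      have hb' : u (0 + 1) < 2 := by exact_mod_cast hb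
      omega
    subst hk0
    induction k with
    | zero => exact hv
    | succ k ih =>
      have := hrest (k + 1) (by omega)
      rw [ih, Int.cast_zero, mul_zero, sub_zero] at this
      exact_mod_cast this
  · exfalso
    obtain ⟨k₂, hk₁₂, hk₂, hk₂'⟩ := hleave 2 two_ne_zero (k₁ + 1) hv
    have hc₁' : c k₁ = (2 - θ) ^ 2 := by rw [hc₁, hv]; simp
    have hc₂ : c k₂ = ((u (k₂ + 1) : ℝ) - θ * 2) ^ 2 := by simp [hc, hk₂]
    have hle₂ := hpair (show k₁ ≠ k₂ by omega)
    rw [hc₁', hc₂] at hle₂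
    have hw : u (k₂ + 1) = 3 := by
      have hlo : ¬ u (k₂ + 1) ≤ 1 := by
        intro h
        have : (u (k₂ + 1) : ℝ) ≤ 1 := by exact_mod_cast h
        nlinarith
      have hhi : ¬ 4 ≤ u (k₂ + 1) := by
        intro h
        have : (4 : ℝ) ≤ u (k₂ + 1) := by exact_mod_cast h
        nlinarith
      omega
    have htriple : c k₁ + (c k₂ + c (k₂ + 1)) ≤ θ ^ 2 := by
      have := hfin {k₁, k₂, k₂ + 1}
      rwa [Finset.sum_insert (by simp; omega), Finset.sum_pair (by omega)] at this
    have hc₃ : c (k₂ + 1) = ((u (k₂ + 1 + 1) : ℝ) - θ * 3) ^ 2 := by simp [hc, hw]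
    rw [hc₁', hc₂, hc₃, hw] at htriple
    push_cast at htriple
    set v := u (k₂ + 1 + 1)
    obtain h | h | h | h : v ≤ 2 ∨ v = 3 ∨ v = 4 ∨ 5 ≤ v := by omega
    · have : (v : ℝ) ≤ 2 := by exact_mod_cast h
      nlinarith
    · rw [h] at htriple
      push_cast at htriple
      nlinarith
    · rw [h] at htriple
      push_cast at htriple
      nlinarith
    · have : (5 : ℝ) ≤ v := by exact_mod_cast h
      nlinarith

/-! ### There are no Pisot numbers close to `1` -/

theorem reverse_X_sub_C {R : Type*} [CommRing R] [IsDomain R] (a : R) :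
    (Polynomial.X - Polynomial.C a).reverse = 1 - Polynomial.C a * Polynomial.X := by
  rw [sub_eq_neg_add, ← Polynomial.C_neg, Polynomial.reverse_C_add, Polynomial.natDegree_X,
    ← one_mul (Polynomial.X : Polynomial R), Polynomial.reverse_mul_X, ← Polynomial.C_1,
    Polynomial.reverse_C]
  simp only [Polynomial.C_1, Polynomial.C_neg]
  ring

theorem reverse_prod_X_sub_C {R : Type*} [CommRing R] [IsDomain R] (S : Multiset R) :
    (S.map fun a => Polynomial.X - Polynomial.C a).prod.reverse
      = (S.map fun a => 1 - Polynomial.C a * Polynomial.X).prod := by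
  induction S using Multiset.induction_on with
  | empty => simpa using Polynomial.reverse_C (1 : R)
  | cons a S ih => simp [Polynomial.reverse_mul_of_domain, ih, reverse_X_sub_C]

theorem reverse_map_of_injective {R S : Type*} [Semiring R] [Semiring S] {f : R →+* S}
    (hf : Function.Injective f) (p : Polynomial R) : (p.map f).reverse = p.reverse.map f := by
  rw [Polynomial.reverse, Polynomial.reverse, Polynomial.natDegree_map_eq_of_injective hf,
    Polynomial.reflect_map]

/-- The complex roots of the minimal polynomial of a Pisot number `θ`: `θ` itself, and simple roots
of modulus less than one. -/
theorem IsPisot.exists_roots {θ : ℝ} (h : IsPisot θ) :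
    ∃ S : Multiset ℂ, ((minpoly ℤ θ).map (Int.castRingHom ℂ)).roots = (θ : ℂ) ::ₘ S ∧
      S.Nodup ∧ ∀ α ∈ S, ‖α‖ < 1 := by
  obtain ⟨h1, hint, hconj⟩ := h
  have hmap : (minpoly ℤ θ).map (Int.castRingHom ℂ) = (minpoly ℚ θ).map (algebraMap ℚ ℂ) := by
    rw [minpoly.isIntegrallyClosed_eq_field_fractions' ℚ hint, Polynomial.map_map]
    congr 1
  have hintQ : IsIntegral ℚ θ := hint.tower_top
  have hne : (minpoly ℚ θ).map (algebraMap ℚ ℂ) ≠ 0 :=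
    (Polynomial.map_ne_zero_iff (algebraMap ℚ ℂ).injective).2 (minpoly.ne_zero hintQ)
  have hmem (z : ℂ) : z ∈ ((minpoly ℚ θ).map (algebraMap ℚ ℂ)).roots ↔
      Polynomial.aeval z (minpoly ℚ θ) = 0 := by
    rw [Polynomial.mem_roots hne, Polynomial.IsRoot, Polynomial.eval_map_algebraMap]
  have hθ : (θ : ℂ) ∈ ((minpoly ℚ θ).map (algebraMap ℚ ℂ)).roots := by
    rw [hmem]
    have := Polynomial.aeval_algebraMap_apply ℂ θ (minpoly ℚ θ)
    rwa [minpoly.aeval, map_zero] at this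
  have hnodup : ((minpoly ℚ θ).map (algebraMap ℚ ℂ)).roots.Nodup :=
    Polynomial.nodup_roots ((minpoly.irreducible hintQ).separable.map)
  obtain ⟨S, hS⟩ := Multiset.exists_cons_of_mem hθ
  rw [hS, Multiset.nodup_cons] at hnodup
  refine ⟨S, by rw [hmap, hS], hnodup.2, fun α hα => hconj α ?_ ?_⟩
  · rw [← hmem, hS]
    exact Multiset.mem_cons_of_mem hα
  · rintro rfl
    exact hnodup.1 hα

/-- Let `p` be the minimal polynomial of `θ` and `p*` its reverse. The power series `F = p / p*`
has integer coefficients, and `(1 - θ X) F` is `X - θ` times a product of Blaschke factors. -/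
theorem IsPisot.exists_powerSeries {θ : ℝ} (h : IsPisot θ) :
    ∃ F : PowerSeries ℤ, F * ((minpoly ℤ θ).reverse : PowerSeries ℤ) = minpoly ℤ θ ∧
      ∀ N : ℕ, ((PowerSeries.coeff 0 F : ℤ) : ℝ) ^ 2 + ∑ k ∈ Finset.range N,
        (((PowerSeries.coeff (k + 1) F : ℤ) : ℝ) - θ * PowerSeries.coeff k F) ^ 2 ≤ 1 + θ ^ 2 := by
  obtain ⟨S, hS, -, hS1⟩ := h.exists_roots
  set p := minpoly ℤ θ with hp
  have hmonic : p.Monic := minpoly.monic h.2.1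
  set f := Int.castRingHom ℂ with hf
  have hfac : p.map f = (Polynomial.X - Polynomial.C (θ : ℂ)) *
      (S.map fun α => Polynomial.X - Polynomial.C α).prod := by
    rw [(IsAlgClosed.splits _).eq_prod_roots_of_monic (hmonic.map f), hS, Multiset.map_cons,
      Multiset.prod_cons]
  -- the multiset of roots is closed under complex conjugation
  have hconj : S.map (starRingEnd ℂ) = S := by
    have h1 : (p.map f).roots.map (starRingEnd ℂ) = (p.map f).roots := by
      rw [Polynomial.roots_map_of_injective_of_card_eq_natDegree (starRingEnd ℂ).injective
        (Polynomial.splits_iff_card_roots.1 (IsAlgClosed.splits _)), Polynomial.map_map]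
      congr 2
      exact RingHom.ext_int _ _
    rw [hS, Multiset.map_cons, Complex.conj_ofReal] at h1
    exact (Multiset.cons_inj_right _).1 h1
  have hrev : p.reverse.map f = (1 - Polynomial.C (θ : ℂ) * Polynomial.X) *
      (S.map fun α => 1 - Polynomial.C (starRingEnd ℂ α) * Polynomial.X).prod := by
    rw [← reverse_map_of_injective (RingHom.injective_int f), hfac,
      Polynomial.reverse_mul_of_domain, reverse_X_sub_C, reverse_prod_X_sub_C]
    conv_lhs => rw [← hconj, Multiset.map_map]
    rfl
  obtain ⟨F, hF⟩ : ∃ F : PowerSeries ℤ, F * (p.reverse : PowerSeries ℤ) = p := by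
    refine ⟨p * PowerSeries.invOfUnit (p.reverse : PowerSeries ℤ) 1, ?_⟩
    rw [mul_assoc, mul_comm (PowerSeries.invOfUnit _ _), PowerSeries.mul_invOfUnit, mul_one]
    simp [hmonic.leadingCoeff]
  refine ⟨F, hF, fun N => ?_⟩
  set G := PowerSeries.map f F with hG
  have hFG : (G * (1 - PowerSeries.C (θ : ℂ) * PowerSeries.X)) *
      (S.map fun α => 1 - PowerSeries.C (starRingEnd ℂ α) * PowerSeries.X).prod
      = (PowerSeries.X - PowerSeries.C (θ : ℂ)) *
        (S.map fun α => PowerSeries.X - PowerSeries.C α).prod := by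
    have h1 := congrArg (PowerSeries.map f) hF
    rw [map_mul, ← Polynomial.polynomial_map_coe, ← Polynomial.polynomial_map_coe, hrev, hfac,
      ← hG] at h1
    have h2 (T : Multiset ℂ) (φ : ℂ → Polynomial ℂ) :
        ((T.map φ).prod : PowerSeries ℂ) = (T.map fun α => (φ α : PowerSeries ℂ)).prod := by
      have := map_multiset_prod (Polynomial.coeToPowerSeries.ringHom (R := ℂ)) (T.map φ)
      rwa [Multiset.map_map] at this
    rw [Polynomial.coe_mul, Polynomial.coe_mul, h2, h2] at h1
    simp only [Polynomial.coe_sub, Polynomial.coe_mul, Polynomial.coe_one, Polynomial.coe_C,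
      Polynomial.coe_X] at h1
    rw [mul_assoc, h1]
  have hle := sum_norm_sq_coeff_le_of_mul_prod_eq S (fun α hα => (hS1 α hα).le) hFG (N + 1)
  have hL : ∑ k ∈ Finset.range (N + 1),
      ‖PowerSeries.coeff k (G * (1 - PowerSeries.C (θ : ℂ) * PowerSeries.X))‖ ^ 2
      = ((PowerSeries.coeff 0 F : ℤ) : ℝ) ^ 2 + ∑ k ∈ Finset.range N,
        (((PowerSeries.coeff (k + 1) F : ℤ) : ℝ) - θ * PowerSeries.coeff k F) ^ 2 := by
    rw [Finset.sum_range_succ', add_comm]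
    congr 1
    · have : PowerSeries.coeff 0 (G * (1 - PowerSeries.C (θ : ℂ) * PowerSeries.X))
          = (((PowerSeries.coeff 0 F : ℤ) : ℝ) : ℂ) := by
        rw [mul_sub, mul_one, map_sub, mul_left_comm, PowerSeries.coeff_C_mul,
          PowerSeries.coeff_zero_mul_X, hG, PowerSeries.coeff_map]
        simp [hf]
      rw [this, Complex.norm_real, Real.norm_eq_abs, sq_abs]
    · refine Finset.sum_congr rfl fun k _ => ?_
      have : PowerSeries.coeff (k + 1) (G * (1 - PowerSeries.C (θ : ℂ) * PowerSeries.X))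
          = ((((PowerSeries.coeff (k + 1) F : ℤ) : ℝ) - θ * PowerSeries.coeff k F : ℝ) : ℂ) := by
        rw [mul_sub, mul_one, map_sub, mul_left_comm, PowerSeries.coeff_C_mul,
          PowerSeries.coeff_succ_mul_X]
        simp [hG, hf]
      rw [this, Complex.norm_real, Real.norm_eq_abs, sq_abs]
  have hR : ∑ k ∈ Finset.range (N + 1),
      ‖PowerSeries.coeff k (PowerSeries.X - PowerSeries.C (θ : ℂ))‖ ^ 2 ≤ 1 + θ ^ 2 := by
    have h0 : ∀ k, 2 ≤ k →
        ‖PowerSeries.coeff k (PowerSeries.X - PowerSeries.C (θ : ℂ))‖ ^ 2 = 0 := by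
      intro k hk
      rw [map_sub, PowerSeries.coeff_X, PowerSeries.coeff_C, if_neg (by omega), if_neg (by omega)]
      simp
    calc _ ≤ ∑ k ∈ Finset.range (N + 2),
          ‖PowerSeries.coeff k (PowerSeries.X - PowerSeries.C (θ : ℂ))‖ ^ 2 :=
          Finset.sum_le_sum_of_subset_of_nonneg (Finset.range_mono (by omega))
            fun _ _ _ => by positivity
      _ = 1 + θ ^ 2 := by
          rw [Finset.sum_range_succ', Finset.sum_range_succ', Finset.sum_eq_zero]
          · simp [PowerSeries.coeff_X]
          · intro k _
            exact h0 _ (by omega)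
  linarith

/-- If `p = ± p*` for the minimal polynomial `p` of a Pisot number `θ` then the roots of `p` are
`θ` and `θ⁻¹`, so `θ + θ⁻¹` is an integer greater than `2`. -/
theorem IsPisot.two_lt_of_eq_reverse {θ : ℝ} (h : IsPisot θ) {e : ℤ} (he : e ≠ 0)
    (hrev : minpoly ℤ θ = Polynomial.C e * (minpoly ℤ θ).reverse) : 2 < θ := by
  obtain ⟨S, hS, hnodup, hS1⟩ := h.exists_roots
  set p := minpoly ℤ θ with hp
  have hmonic : p.Monic := minpoly.monic h.2.1
  set f := Int.castRingHom ℂ with hf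
  have hfinj : Function.Injective f := RingHom.injective_int f
  have hne : p.map f ≠ 0 := (hmonic.map f).ne_zero
  have hθ1 := h.1
  have hθ0 : (θ : ℂ) ≠ 0 := by exact_mod_cast (by linarith : θ ≠ 0)
  have hinv (z : ℂ) (hz0 : z ≠ 0) (hz : z ∈ (p.map f).roots) : z⁻¹ ∈ (p.map f).roots := by
    rw [Polynomial.mem_roots hne, Polynomial.IsRoot, Polynomial.eval_map] at hz ⊢
    let _ := invertibleOfNonzero hz0
    have h1 := Polynomial.eval₂_reverse_mul_pow f z p
    rw [hz, invOf_eq_inv] at h1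
    have h2 := (mul_eq_zero.1 h1).resolve_right (pow_ne_zero _ hz0)
    rw [hrev, Polynomial.eval₂_mul, h2, mul_zero]
  have hz0 (z : ℂ) (hz : z ∈ (p.map f).roots) : z ≠ 0 := by
    rintro rfl
    rw [Polynomial.mem_roots hne, Polynomial.IsRoot, Polynomial.eval_map,
      Polynomial.eval₂_at_zero, ← map_zero f, hfinj.eq_iff, hrev, Polynomial.coeff_C_mul,
      Polynomial.coeff_zero_reverse, hmonic.leadingCoeff, mul_one] at hz
    exact he hz
  have hSeq : S = {(θ : ℂ)⁻¹} := by
    have hall : ∀ z ∈ S, z = (θ : ℂ)⁻¹ := by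
      intro z hz
      have hzr : z ∈ (p.map f).roots := by rw [hS]; exact Multiset.mem_cons_of_mem hz
      have hi := hinv z (hz0 z hzr) hzr
      rw [hS, Multiset.mem_cons] at hi
      rcases hi with hi | hi
      · rw [← hi, inv_inv]
      · have a := hS1 _ hz
        have b := hS1 _ hi
        have c : ‖z‖ * ‖z⁻¹‖ = 1 := by rw [← norm_mul, mul_inv_cancel₀ (hz0 z hzr), norm_one]
        nlinarith [norm_nonneg z, norm_nonneg z⁻¹]
    have hmem : (θ : ℂ)⁻¹ ∈ S := by
      have hi := hinv θ hθ0 (by rw [hS]; exact Multiset.mem_cons_self _ _)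
      rw [hS, Multiset.mem_cons] at hi
      refine hi.resolve_left fun hi => ?_
      have : θ⁻¹ = θ := by exact_mod_cast hi
      have : θ⁻¹ < 1 := inv_lt_one_of_one_lt₀ hθ1
      linarith
    refine (Multiset.Nodup.ext hnodup (Multiset.nodup_singleton _)).2 fun z => ?_
    rw [Multiset.mem_singleton]
    exact ⟨hall z, fun hz => hz ▸ hmem⟩
  have hnext := (IsAlgClosed.splits (p.map f)).nextCoeff_eq_neg_sum_roots_of_monic (hmonic.map f)
  rw [hS, hSeq, Polynomial.nextCoeff_map hfinj] at hnext
  obtain ⟨a, ha⟩ : ∃ a : ℤ, (a : ℝ) = θ + θ⁻¹ := by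
    refine ⟨-p.nextCoeff, ?_⟩
    have : (p.nextCoeff : ℂ) = -(θ + (θ : ℂ)⁻¹) := by simpa [hf] using hnext
    have h' : (p.nextCoeff : ℝ) = -(θ + θ⁻¹) := by exact_mod_cast this
    push_cast
    rw [h']
    ring
  have hi1 : θ⁻¹ < 1 := inv_lt_one_of_one_lt₀ hθ1
  have hmul : θ * θ⁻¹ = 1 := mul_inv_cancel₀ (by linarith)
  have ha2 : (2 : ℝ) < a := by rw [ha]; nlinarith
  have ha3 : (3 : ℝ) ≤ a := by
    have : 2 < a := by exact_mod_cast ha2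
    exact_mod_cast this
  linarith

/-- There are no Pisot numbers close to `1`. -/
theorem IsPisot.lt_of_isPisot {θ : ℝ} (h : IsPisot θ) : 1.1515 < θ := by
  by_contra! hle
  have h1 := h.1
  obtain ⟨F, hF, hsum⟩ := h.exists_powerSeries
  set u : ℕ → ℤ := fun k => PowerSeries.coeff k F with hu
  have hp0 : (minpoly ℤ θ).coeff 0 ≠ 0 := by
    intro h0
    have hmap := minpoly.isIntegrallyClosed_eq_field_fractions' ℚ h.2.1
    have hQ : (minpoly ℚ θ).coeff 0 = 0 := by rw [hmap, Polynomial.coeff_map, h0, map_zero]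
    rw [minpoly.coeff_zero_eq_zero h.2.1.tower_top] at hQ
    linarith
  have hu0 : u 0 = (minpoly ℤ θ).coeff 0 := by
    have := congrArg (PowerSeries.coeff 0) hF
    have hmul := PowerSeries.coeff_mul 0 F ((minpoly ℤ θ).reverse : PowerSeries ℤ)
    rw [Finset.Nat.antidiagonal_zero, Finset.sum_singleton] at hmul
    rw [hmul, Polynomial.coeff_coe, Polynomial.coeff_coe,
      Polynomial.coeff_zero_reverse, (minpoly.monic h.2.1).leadingCoeff, mul_one] at this
    exact this
  have hu1 : u 0 = 1 ∨ u 0 = -1 := by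
    have hne : u 0 ≠ 0 := hu0 ▸ hp0
    have h0 := hsum 0
    rw [Finset.sum_range_zero, add_zero] at h0
    have h4 : ((u 0 : ℝ)) ^ 2 < 4 := by
      refine h0.trans_lt ?_
      nlinarith
    have h4' : (u 0) ^ 2 < 4 := by exact_mod_cast h4
    have : u 0 < 2 := by nlinarith
    have : -2 < u 0 := by nlinarith
    omega
  have hz : ∀ k, u (k + 1) = 0 := by
    have hsq : (u 0 : ℝ) ^ 2 = 1 := by rcases hu1 with e | e <;> rw [e] <;> norm_num
    intro k
    rcases hu1 with e | e
    · refine eq_zero_of_sum_sq_sub_mul_le h1 hle e (fun N => ?_) k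
      have := hsum N
      change (u 0 : ℝ) ^ 2 + _ ≤ _ at this
      rw [hsq] at this
      exact le_of_add_le_add_left this
    · refine neg_eq_zero.1 (eq_zero_of_sum_sq_sub_mul_le (u := fun k => -u k) h1 hle (by simp [e])
        (fun N => ?_) k)
      have := hsum N
      change (u 0 : ℝ) ^ 2 + _ ≤ _ at this
      rw [hsq] at this
      refine le_trans (le_of_eq (Finset.sum_congr rfl fun k _ => ?_)) (le_of_add_le_add_left this)
      push_cast
      ring
  have hFC : F = PowerSeries.C (u 0) := by
    ext k
    cases k with
    | zero => simp [hu]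
    | succ k => rw [PowerSeries.coeff_C, if_neg (by omega)]; exact hz k
  have hrev : minpoly ℤ θ = Polynomial.C (u 0) * (minpoly ℤ θ).reverse := by
    apply Polynomial.coe_injective ℤ
    rw [Polynomial.coe_mul, Polynomial.coe_C, ← hFC, hF]
  have := h.two_lt_of_eq_reverse (hu0 ▸ hp0) hrev
  linarith

/-! ### The square root of the second Pisot number -/

theorem IsSecondPisot.lt {P : ℝ} (h : IsSecondPisot P) : P < 1.381 := by
  obtain ⟨-, θ, -, huniq⟩ := h
  obtain ⟨θ₁, h₁, -, hu₁⟩ := exists_isPisot_cubic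
  obtain ⟨θ₂, h₂, hl₂, hu₂⟩ := exists_isPisot_quartic
  by_contra! hP
  have e₁ := huniq θ₁ ⟨h₁, by linarith⟩
  have e₂ := huniq θ₂ ⟨h₂, by linarith⟩
  linarith

/-- If `-q` is not a conjugate of `q` and `q ^ 2` is a Pisot number, then so is `q`. -/
theorem isPisot_of_isPisot_sq {q : ℝ} (h1 : 1 < q) (hsq : IsPisot (q ^ 2))
    (hneg : Polynomial.aeval (-q) (minpoly ℚ q) ≠ 0) : IsPisot q := by
  obtain ⟨-, hint, hconj⟩ := hsq
  refine ⟨h1, IsIntegral.of_pow two_pos hint, fun z hz hne => ?_⟩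
  have hd : minpoly ℚ q ∣ (minpoly ℚ (q ^ 2)).comp (Polynomial.X ^ 2) := by
    apply minpoly.dvd
    rw [Polynomial.aeval_comp, map_pow, Polynomial.aeval_X, minpoly.aeval]
  obtain ⟨r, hr⟩ := hd
  have hz2 : Polynomial.aeval (z ^ 2) (minpoly ℚ (q ^ 2)) = 0 := by
    have : Polynomial.aeval z ((minpoly ℚ (q ^ 2)).comp (Polynomial.X ^ 2)) = 0 := by
      rw [hr, map_mul, hz, zero_mul]
    rwa [Polynomial.aeval_comp, map_pow, Polynomial.aeval_X] at this
  have hlt := hconj _ hz2 fun h => ?_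
  · rw [norm_pow] at hlt
    exact (sq_lt_one_iff₀ (norm_nonneg z)).1 hlt
  · push_cast at h
    rcases sq_eq_sq_iff_eq_or_eq_neg.1 h with h | h
    · exact hne h
    · apply hneg
      have := Polynomial.aeval_algebraMap_apply ℂ (-q) (minpoly ℚ q)
      rw [Complex.coe_algebraMap, Complex.ofReal_neg, ← h, hz] at this
      exact_mod_cast this.symm

/-- If `√P` were a Pisot number, it would be the only Pisot number below `P`; as it is too small to
be the root of `X³ - X - 1`, it would be closer to `1` than a Pisot number can be. -/
theorem IsSecondPisot.not_isPisot_of_sq {q : ℝ} (h1 : 1 < q) (h : IsSecondPisot (q ^ 2)) :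
    ¬ IsPisot q := by
  intro hq
  have hlt := h.lt
  obtain ⟨-, θ, -, huniq⟩ := h
  obtain ⟨θ₁, h₁, hl₁, hu₁⟩ := exists_isPisot_cubic
  have hq' := hq.lt_of_isPisot
  rcases lt_or_ge θ₁ (q ^ 2) with h | h
  · have e₁ := huniq θ₁ ⟨h₁, h⟩
    have e₂ := huniq q ⟨hq, by nlinarith⟩
    nlinarith
  · nlinarith

/-- If `-q` is a conjugate of `q`, then `1` and `q` are linearly independent over the polynomials
in `q ^ 2`. -/
theorem powSum_eq_of_add_eq {q : ℝ} (h1 : 1 < q)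
    (hneg : Polynomial.aeval (-q) (minpoly ℚ q) = 0) (A A' B B' : Finset ℕ)
    (h : q * powSum (q ^ 4) A + q ^ 2 * powSum (q ^ 4) B
      = q * powSum (q ^ 4) A' + q ^ 2 * powSum (q ^ 4) B') :
    powSum (q ^ 4) A = powSum (q ^ 4) A' ∧ powSum (q ^ 4) B = powSum (q ^ 4) B' := by
  let σ (E : Finset ℕ) : Polynomial ℚ := ∑ i ∈ E, (Polynomial.X ^ 4) ^ i
  have hσ (x : ℝ) (E : Finset ℕ) : Polynomial.aeval x (σ E) = powSum (x ^ 4) E := by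
    simp [σ, powSum]
  let D : Polynomial ℚ := Polynomial.X * (σ A - σ A') + Polynomial.X ^ 2 * (σ B - σ B')
  have hD (x : ℝ) : Polynomial.aeval x D = x * (powSum (x ^ 4) A - powSum (x ^ 4) A')
      + x ^ 2 * (powSum (x ^ 4) B - powSum (x ^ 4) B') := by
    simp only [D, map_add, map_mul, map_sub, map_pow, Polynomial.aeval_X, hσ]
  have hDq : Polynomial.aeval q D = 0 := by
    rw [hD]
    linear_combination h
  obtain ⟨r, hr⟩ := minpoly.dvd ℚ q hDq
  have hDn : Polynomial.aeval (-q) D = 0 := by rw [hr, map_mul, hneg, zero_mul]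
  rw [hD] at hDq hDn
  rw [show (-q) ^ 4 = q ^ 4 by ring] at hDn
  constructor
  · apply mul_left_cancel₀ (by linarith : q ≠ 0)
    linear_combination (hDq - hDn) / 2
  · apply mul_left_cancel₀ (by positivity : q ^ 2 ≠ 0)
    linear_combination (hDq + hDn) / 2

theorem proposition1p6 (P : ℝ) (hP : IsSecondPisot P) : bigL 1 (Real.sqrt P) = 0 := by
  have hP1 : 1 < P := hP.1.1
  have hlt := hP.lt
  have hq1 : 1 < Real.sqrt P := Real.lt_sqrt_of_sq_lt (by linarith)
  have hq2 : Real.sqrt P ^ 2 = P := Real.sq_sqrt (by linarith)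
  set q := Real.sqrt P
  rw [← hq2] at hP
  have hneg : Polynomial.aeval (-q) (minpoly ℚ q) = 0 := by
    by_contra hne
    exact hP.not_isPisot_of_sq hq1 (isPisot_of_isPisot_sq hq1 hP.1 hne)
  have hq4 : q ^ 4 ≤ 2 := by
    rw [show q ^ 4 = (q ^ 2) ^ 2 by ring, hq2]
    nlinarith
  exact bigL_eq_zero_of_near le_rfl hq1 fun ε hε => exists_spectrumSet_near hq1 hq4
    (fun δ hδ => exists_powSum_sub_lt hq1 hq4 (powSum_eq_of_add_eq hq1 hneg) hδ) hε
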